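/- Let $d\ge 0$ and $D,n,T\ge 1$ be integers and $\varepsilon>0$. Let $k(x,x')=k(x-x')$ be a real shift-invariant kernel on $\mathbb R^d$ with $k(\delta)=\int e^{i\langle v,\delta\rangle}\,dp(v)$ for a probability measure $p$ with finite second moment $\sigma_p^2=E_{v\sim p}[v^Tv]$. Draw $u_1,\dots,u_D$ independently from $p$ and let $$z(x)=D^{-1/2}\bigl(\cos\langle u_1,x\rangle,\dots,\cos\langle u_D,x\rangle,\sin\langle u_1,x\rangle,\dots,\sin\langle u_D,x\rangle\bigr)\in\mathbb R^{2D}.$$ Let $P$ be a probability distribution of labelled examples $(x,y)\in\mathbb R^d\times\{1,-1\}$ whose inputs lie almost surely in a bounded set $M$ of diameter $R$. Let $l(w;(x,y))=\varphi(y,w^Tz(x))$ be a loss that is, as a function of $w\in\mathbb R^{2D}$, for all frequencies $u_1,\dots,u_D$, all $x\in M$ and $y\in\{1,-1\}$, convex and differentiable with $\|\nabla l\|\le L$, where $L>0$, and with $\beta$-Lipschitz gradient (for instance the Huber-hinge loss). Write $R[w]=E_{(x,y)\sim P}\,l(w;(x,y))$ and, for a sample $S=((x_1,y_1),\dots,(x_n,y_n))\sim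 P^n$, $R_S[w]=\frac1n\sum_{i=1}^n l(w;(x_i,y_i))$. With probability at least $1-2^8\left(\frac{\sigma_pR}{\varepsilon}\right)^2\exp\left(\frac{-D\varepsilon^2}{4(d+2)}\right)$ over $u_1,\dots,u_D$ the following holds. Suppose that for almost every $S$ a minimizer of $R_S$ over $\mathbb R^{2D}$ has the form $w^S_*=\sum_{t=1}^m\alpha^*_t z(c_t)$, where the support vectors $c_t$ are among $x_1,\dots,x_n$; here $m$ is any fixed number and $\alpha^*_t$, $c_t$ may depend on $S$. Let $f^*(x)=\sum_{t=1}^m\alpha_t^*k(x,c_t)$ be the corresponding kernel expansion, $\|f^*\|_1=\sum_{t=1}^m|\alpha^*_t|$, and let $B\ge0$ be a number with $E_S\|f^*\|_1^2\le B^2$ (so $B=\|f^*\|_1$ if this norm does not depend on $S$). Let $$\eta=\frac{B\sqrt{(1+\varepsilon)n}}{L\sqrt{T(n+2T)}},\qquad\text{and assume } \eta\beta\le 2 .$$ Let $w_1=0$, $w_{t+1}=w_t-\eta\nabla l(w_t;(x_{i_t},y_{i_t}))$ with independent indices $i_t$ uniform on $\{1,\dots,n\}$, be the stochastic gradient method on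 $S$, and $\bar w_T=\frac1T\sum_{t=1}^Tw_t$. Then the following expectations, over $S$ and the indices, exist and $$E\bigl[R[\bar w_T]\bigr]\le E\bigl[R_S[w^S_*]\bigr]+\frac{B\,L\sqrt{1+\varepsilon}}{\sqrt n}\sqrt{\frac{n+2T}{T}} .$$ -/

import Mathlib

open MeasureTheory ProbabilityTheory
open scoped BigOperators RealInnerProductSpace Gradient

noncomputable section

/-- The input space `ℝ^d` with its Euclidean norm. -/
abbrev Input (d : ℕ) := EuclideanSpace ℝ (Fin d)

/-- The binary labels `{+1, -1}`. -/
abbrev Label := ({1, -1} : Set ℝ)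

/-- Labelled examples `(x, y)`. -/
abbrev Example (d : ℕ) := Input d × Label

/-- The weight space `ℝ^{2D}` with its Euclidean norm. -/
abbrev Weight (D : ℕ) := EuclideanSpace ℝ (Fin D ⊕ Fin D)

/-- The random Fourier feature map
`z(x) = D^{-1/2} (cos⟨u₁,x⟩, …, cos⟨u_D,x⟩, sin⟨u₁,x⟩, …, sin⟨u_D,x⟩)`
attached to the frequencies `u₁, …, u_D`. -/
def fourierFeature {d D : ℕ} (u : Fin D → Input d) (x : Input d) : Weight D :=
  WithLp.toLp 2 (Sum.elim (fun j => Real.cos ⟪u j, x⟫ / Real.sqrt D)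
    (fun j => Real.sin ⟪u j, x⟫ / Real.sqrt D))

/-- The loss `l(w; (x, y)) = φ(y, wᵀ z(x))` of the linear predictor `w` on the example `(x, y)`. -/
def exampleLoss {d D : ℕ} (φ : Label → ℝ → ℝ) (u : Fin D → Input d) (e : Example d)
    (w : Weight D) : ℝ :=
  φ e.2 ⟪w, fourierFeature u e.1⟫

/-- The population risk `R(w) = E_{(x,y) ∼ P} l(w; (x, y))`. -/
def risk {d D : ℕ} (φ : Label → ℝ → ℝ) (u : Fin D → Input d) (P : Measure (Example d))
    (w : Weight D) : ℝ :=
  ∫ e, exampleLoss φ u e w ∂P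

/-- The empirical risk `R_S(w) = (1/n) ∑ᵢ l(w; (xᵢ, yᵢ))`. -/
def empRisk {d D n : ℕ} (φ : Label → ℝ → ℝ) (u : Fin D → Input d) (S : Fin n → Example d)
    (w : Weight D) : ℝ :=
  (1 / (n : ℝ)) * ∑ i, exampleLoss φ u (S i) w

/-- The function `g` is convex and differentiable, its gradient is bounded by `L`
(so `g` is `L`-Lipschitz), and its gradient is `β`-Lipschitz (so `g` is `β`-smooth). -/
structure ConvexLipschitzSmooth {D : ℕ} (L β : ℝ) (g : Weight D → ℝ) : Prop where
  convex : ConvexOn ℝ Set.univ g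
  differentiable : Differentiable ℝ g
  gradient_le : ∀ w, ‖∇ g w‖ ≤ L
  gradient_lipschitz : ∀ v w, ‖∇ g v - ∇ g w‖ ≤ β * ‖v - w‖

/-- The point reached from `w₁ = 0` after one gradient step of size `η` on each of the examples
`e 0, …, e (t - 1)`, in this order. -/
def sgmIterate {d D : ℕ} (φ : Label → ℝ → ℝ) (u : Fin D → Input d) (η : ℝ) :
    (t : ℕ) → (Fin t → Example d) → Weight D
  | 0, _ => 0
  | t + 1, e =>
    sgmIterate φ u η t (Fin.init e) -
      η • ∇ (exampleLoss φ u (e (Fin.last t))) (sgmIterate φ u η t (Fin.init e))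

/-- The average `w̄_T = (1/T) ∑_{t=1}^T w_t` of the iterates of the stochastic gradient method on
the training set `S`, where step `t` uses the training example with index `i t`; the iterate `w_t`
is the point reached after `t - 1` steps. -/
def sgmAverage {d D n T : ℕ} (φ : Label → ℝ → ℝ) (u : Fin D → Input d) (η : ℝ)
    (S : Fin n → Example d) (i : Fin T → Fin n) : Weight D :=
  (1 / (T : ℝ)) • ∑ t : Fin T,
    sgmIterate φ u η t (fun s : Fin t => S (i (Fin.castLE t.isLt.le s)))

/-- The law of a training set of `n` independent examples drawn from `P`. -/
def sampleLaw {d : ℕ} (n : ℕ) (P : Measure (Example d)) : Measure (Fin n → Example d) :=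
  Measure.pi fun _ => P

/-- The law of `T` independent indices, each uniform on the `n` training examples. -/
def indexLaw (n T : ℕ) : Measure (Fin T → Fin n) :=
  Measure.pi fun _ => uniformOn (Set.univ : Set (Fin n))

/-- The linear model `∑ₜ αₜ z(cₜ)` that corresponds to the kernel expansion
`∑ₜ αₜ k(·, cₜ)`. -/
def expansionWeight {d D m : ℕ} (u : Fin D → Input d) (α : Fin m → ℝ) (c : Fin m → Input d) :
    Weight D :=
  ∑ t, α t • fourierFeature u (c t)

/-- The function `f = ∑ₜ αₜ k(·, cₜ)`, with support vectors `cₜ` among the training inputs, is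
the kernel expansion of a minimizer of the empirical risk over `ℝ^{2D}`: the corresponding
linear model `∑ₜ αₜ z(cₜ)` minimizes `R_S`. The shift-invariant kernel is `k(x, x') = k(x - x')`. -/
structure IsERMExpansion {d D n m : ℕ} (k : Input d → ℝ) (φ : Label → ℝ → ℝ)
    (u : Fin D → Input d) (S : Fin n → Example d)
    (f : Input d → ℝ) (α : Fin m → ℝ) (c : Fin m → Input d) : Prop where
  support_mem : ∀ t, ∃ i, c t = (S i).1
  expansion : ∀ x, f x = ∑ t, α t * k (x - c t)
  minimizes : ∀ w, empRisk φ u S (expansionWeight u α c) ≤ empRisk φ u S w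

/-- The step size `η = B √((1+ε) n) / (L √(T (n + 2T)))`, which minimizes
`(1+ε) B² / (2Tη) + η L² / 2 + T L² η / n`. -/
def optimalStep (B L ε : ℝ) (n T : ℕ) : ℝ :=
  B * Real.sqrt ((1 + ε) * n) / (L * Real.sqrt (T * (n + 2 * T)))

/-- `σ_p`, the square root of the second moment `E_p[uᵀu]`. -/
def sigmaP {d : ℕ} (p : Measure (Input d)) : ℝ :=
  Real.sqrt (∫ v, ‖v‖ ^ 2 ∂p)

end

/-- The scalar loss `ψ` is convex and differentiable, with derivative bounded by `L` and
`β`-Lipschitz. -/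
structure SmoothConvexLink (L β : ℝ) (ψ : ℝ → ℝ) : Prop where
  convex : ConvexOn ℝ Set.univ ψ
  differentiable : Differentiable ℝ ψ
  abs_deriv_le : ∀ s, |deriv ψ s| ≤ L
  abs_deriv_sub_le : ∀ s t, |deriv ψ s - deriv ψ t| ≤ β * |s - t|

namespace SmoothConvexLink

variable {L β : ℝ} {ψ : ℝ → ℝ}

theorem monotone_deriv (h : SmoothConvexLink L β ψ) : Monotone (deriv ψ) := fun s t hst =>
  h.convex.monotoneOn_deriv (fun x _ => h.differentiable x) (Set.mem_univ s) (Set.mem_univ t) hst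

theorem abs_sub_le (h : SmoothConvexLink L β ψ) (s t : ℝ) : |ψ s - ψ t| ≤ L * |s - t| :=
  convex_univ.norm_image_sub_le_of_norm_deriv_le (fun x _ => h.differentiable x)
    (fun x _ => h.abs_deriv_le x) (Set.mem_univ t) (Set.mem_univ s)

theorem continuous_deriv (h : SmoothConvexLink L β ψ) : Continuous (deriv ψ) := by
  refine (LipschitzWith.of_dist_le_mul (K := β.toNNReal) fun s t => ?_).continuous
  rw [Real.dist_eq, Real.dist_eq]
  exact (h.abs_deriv_sub_le s t).trans
    (mul_le_mul_of_nonneg_right (Real.le_coe_toNNReal β) (abs_nonneg _))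

theorem sub_le_deriv_mul (h : SmoothConvexLink L β ψ) (s t : ℝ) :
    ψ s - ψ t ≤ deriv ψ s * (s - t) := by
  have hd := (h.differentiable s).hasDerivAt
  rcases lt_trichotomy s t with hst | rfl | hst
  · have := h.convex.le_slope_of_hasDerivAt (Set.mem_univ s) (Set.mem_univ t) hst hd
    rw [slope_def_field, le_div_iff₀ (sub_pos.2 hst)] at this
    linarith
  · simp
  · have := h.convex.slope_le_of_hasDerivAt (Set.mem_univ t) (Set.mem_univ s) hst hd
    rw [slope_def_field, div_le_iff₀ (sub_pos.2 hst)] at this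
    linarith

/-- A gradient step of size `η ≤ 2 / β` on `w ↦ ψ ⟪w, z⟫` is nonexpansive. -/
theorem norm_step_sub_step_le {E : Type*} [NormedAddCommGroup E] [InnerProductSpace ℝ E]
    (h : SmoothConvexLink L β ψ) {η : ℝ} (hη : 0 ≤ η) (hηβ : η * β ≤ 2) {z : E} (hz : ‖z‖ = 1)
    (v w : E) :
    ‖(v - η • deriv ψ ⟪v, z⟫ • z) - (w - η • deriv ψ ⟪w, z⟫ • z)‖ ≤ ‖v - w‖ := by
  set a := ⟪v, z⟫ with ha
  set b := ⟪w, z⟫ with hb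
  set δ := deriv ψ a - deriv ψ b with hδ
  have hab : ⟪v - w, z⟫ = a - b := inner_sub_left v w z
  have heq : (v - η • deriv ψ a • z) - (w - η • deriv ψ b • z) = (v - w) - (η * δ) • z := by
    rw [hδ]; module
  rw [heq]
  refine le_of_sq_le_sq ?_ (norm_nonneg _)
  rw [norm_sub_sq_real, inner_smul_right, hab, norm_smul, hz, mul_one, Real.norm_eq_abs, sq_abs]
  have hmono : δ * (a - b) = |δ| * |a - b| := by
    rw [← abs_mul, abs_of_nonneg]
    rcases le_total a b with hle | hle
    · exact mul_nonneg_of_nonpos_of_nonpos (sub_nonpos.2 (h.monotone_deriv hle)) (sub_nonpos.2 hle)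
    · exact mul_nonneg (sub_nonneg.2 (h.monotone_deriv hle)) (sub_nonneg.2 hle)
  have hstep : η * |δ| ≤ 2 * |a - b| := calc
    η * |δ| ≤ η * (β * |a - b|) := mul_le_mul_of_nonneg_left (h.abs_deriv_sub_le a b) hη
    _ = (η * β) * |a - b| := by ring
    _ ≤ 2 * |a - b| := mul_le_mul_of_nonneg_right hηβ (abs_nonneg _)
  have hprod : (η * |δ|) * (η * |δ|) ≤ (η * |δ|) * (2 * |a - b|) :=
    mul_le_mul_of_nonneg_left hstep (mul_nonneg hη (abs_nonneg _))
  have hsq : (η * δ) ^ 2 = (η * |δ|) * (η * |δ|) := by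
    rw [mul_pow, ← sq_abs δ]; ring
  rw [hsq, mul_assoc η δ, hmono]
  linarith

end SmoothConvexLink

variable {d D : ℕ}

theorem norm_fourierFeature (hD : 1 ≤ D) (u : Fin D → Input d) (x : Input d) :
    ‖fourierFeature u x‖ = 1 := by
  have hD0 : (0 : ℝ) < D := by exact_mod_cast hD
  rw [EuclideanSpace.norm_eq, Real.sqrt_eq_one]
  simp only [fourierFeature, Fintype.sum_sum_type, Sum.elim_inl, Sum.elim_inr, Real.norm_eq_abs,
    sq_abs, div_pow, Real.sq_sqrt hD0.le]
  rw [← Finset.sum_add_distrib]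
  simp only [← add_div, Real.cos_sq_add_sin_sq]
  simp [hD0.ne']

theorem continuous_fourierFeature (u : Fin D → Input d) : Continuous (fourierFeature u) := by
  refine (PiLp.continuous_toLp 2 _).comp (continuous_pi fun j => ?_)
  rcases j with j | j <;> simp only [Sum.elim_inl, Sum.elim_inr] <;> fun_prop

/-- The features are unit vectors, so their inner products are at most `1` for all frequencies. -/
theorem norm_expansionWeight_le (hD : 1 ≤ D) {m : ℕ} (u : Fin D → Input d) (α : Fin m → ℝ)
    (c : Fin m → Input d) : ‖expansionWeight u α c‖ ≤ ∑ t, |α t| := by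
  refine (norm_sum_le _ _).trans_eq (Finset.sum_congr rfl fun t _ => ?_)
  rw [norm_smul, norm_fourierFeature hD, mul_one, Real.norm_eq_abs]

theorem hasGradientAt_exampleLoss {φ : Label → ℝ → ℝ} (hφ : ∀ y, Differentiable ℝ (φ y))
    (u : Fin D → Input d) (e : Example d) (w : Weight D) :
    HasGradientAt (exampleLoss φ u e)
      (deriv (φ e.2) ⟪w, fourierFeature u e.1⟫ • fourierFeature u e.1) w := by
  set z := fourierFeature u e.1
  have hin : HasFDerivAt (fun w : Weight D => ⟪w, z⟫) (innerSL ℝ z) w := by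
    have heq : (fun w : Weight D => ⟪w, z⟫) = innerSL ℝ z := funext fun v => real_inner_comm z v
    rw [heq]
    exact (innerSL ℝ z).hasFDerivAt
  have h := (hφ e.2 ⟪w, z⟫).hasDerivAt.comp_hasFDerivAt w hin
  rw [hasGradientAt_iff_hasFDerivAt]
  have heq : InnerProductSpace.toDual ℝ (Weight D) (deriv (φ e.2) ⟪w, z⟫ • z)
      = deriv (φ e.2) ⟪w, z⟫ • innerSL ℝ z := by
    ext v
    simp
  rw [heq]
  exact h

theorem gradient_exampleLoss {φ : Label → ℝ → ℝ} (hφ : ∀ y, Differentiable ℝ (φ y))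
    (u : Fin D → Input d) (e : Example d) (w : Weight D) :
    ∇ (exampleLoss φ u e) w =
      deriv (φ e.2) ⟪w, fourierFeature u e.1⟫ • fourierFeature u e.1 :=
  (hasGradientAt_exampleLoss hφ u e w).gradient

/-- The properties of the loss as a function of the weights pass to the scalar loss, which is its
restriction to the line spanned by a feature vector. -/
theorem ConvexLipschitzSmooth.smoothConvexLink (hD : 1 ≤ D) {φ : Label → ℝ → ℝ} {L β : ℝ}
    {u : Fin D → Input d} {x : Input d} (h : ∀ y, ConvexLipschitzSmooth L β (exampleLoss φ u (x, y)))
    (y : Label) : SmoothConvexLink L β (φ y) := by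
  set z := fourierFeature u x with hz
  have hz1 : ‖z‖ = 1 := norm_fourierFeature hD u x
  have hline : ∀ s : ℝ, ⟪s • z, z⟫ = s := fun s => by
    rw [real_inner_smul_left, real_inner_self_eq_norm_sq, hz1]; ring
  have hψ : ∀ y, φ y = exampleLoss φ u (x, y) ∘ LinearMap.toSpanSingleton ℝ (Weight D) z := by
    intro y
    funext s
    simp only [Function.comp_apply, LinearMap.toSpanSingleton_apply, exampleLoss]
    rw [← hz, hline]
  have hdiff : ∀ y, Differentiable ℝ (φ y) := fun y => by
    rw [hψ y]
    exact (h y).differentiable.comp (differentiable_id.smul_const z)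
  have hgrad : ∀ s : ℝ, ∇ (exampleLoss φ u (x, y)) (s • z) = deriv (φ y) s • z := fun s => by
    rw [gradient_exampleLoss hdiff]
    simp only [← hz, hline]
  refine ⟨?_, hdiff y, fun s => ?_, fun s t => ?_⟩
  · rw [hψ y]
    exact (h y).convex.comp_linearMap _
  · have := (h y).gradient_le (s • z)
    rwa [hgrad, norm_smul, hz1, mul_one, Real.norm_eq_abs] at this
  · have := (h y).gradient_lipschitz (s • z) (t • z)
    rwa [hgrad, hgrad, ← sub_smul, ← sub_smul, norm_smul, norm_smul, hz1, mul_one, mul_one,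
      Real.norm_eq_abs, Real.norm_eq_abs] at this

section Loss

variable {φ : Label → ℝ → ℝ} {L β : ℝ}

theorem exampleLoss_sub_le (hD : 1 ≤ D) (hφ : ∀ y, SmoothConvexLink L β (φ y))
    (u : Fin D → Input d) (e : Example d) (v w : Weight D) :
    |exampleLoss φ u e v - exampleLoss φ u e w| ≤ L * ‖v - w‖ := by
  refine ((hφ e.2).abs_sub_le _ _).trans
    (mul_le_mul_of_nonneg_left ?_ ((abs_nonneg _).trans ((hφ e.2).abs_deriv_le 0)))
  rw [← inner_sub_left]
  simpa [norm_fourierFeature hD] using abs_real_inner_le_norm (v - w) (fourierFeature u e.1)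

theorem abs_exampleLoss_le (hD : 1 ≤ D) (hφ : ∀ y, SmoothConvexLink L β (φ y)) {C : ℝ}
    (hC : ∀ y, |φ y 0| ≤ C) (u : Fin D → Input d) (e : Example d) (w : Weight D) :
    |exampleLoss φ u e w| ≤ C + L * ‖w‖ := by
  have h1 := exampleLoss_sub_le hD hφ u e w 0
  have h2 : |exampleLoss φ u e 0| ≤ C := by simpa [exampleLoss] using hC e.2
  rw [sub_zero] at h1
  have h3 := abs_sub_abs_le_abs_sub (exampleLoss φ u e w) (exampleLoss φ u e 0)
  linarith

theorem exampleLoss_sub_le_inner_gradient (hφ : ∀ y, SmoothConvexLink L β (φ y))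
    (u : Fin D → Input d) (e : Example d) (v w : Weight D) :
    exampleLoss φ u e v - exampleLoss φ u e w ≤ ⟪∇ (exampleLoss φ u e) v, v - w⟫ := by
  rw [gradient_exampleLoss fun y => (hφ y).differentiable, real_inner_smul_left,
    real_inner_comm (v - w), inner_sub_left]
  exact (hφ e.2).sub_le_deriv_mul _ _

theorem norm_gradient_exampleLoss_le (hD : 1 ≤ D) (hφ : ∀ y, SmoothConvexLink L β (φ y))
    (u : Fin D → Input d) (e : Example d) (w : Weight D) : ‖∇ (exampleLoss φ u e) w‖ ≤ L := by
  rw [gradient_exampleLoss fun y => (hφ y).differentiable, norm_smul, norm_fourierFeature hD,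
    mul_one]
  exact (hφ e.2).abs_deriv_le _

theorem convexOn_exampleLoss (hφ : ∀ y, SmoothConvexLink L β (φ y)) (u : Fin D → Input d)
    (e : Example d) : ConvexOn ℝ Set.univ (exampleLoss φ u e) := by
  have h := (hφ e.2).convex.comp_linearMap (innerₗ (Weight D) (fourierFeature u e.1))
  refine h.congr fun w _ => ?_
  simp [exampleLoss, real_inner_comm]

theorem measurable_exampleLoss (hφ : ∀ y, SmoothConvexLink L β (φ y)) (u : Fin D → Input d) :
    Measurable fun q : Example d × Weight D => exampleLoss φ u q.1 q.2 := by
  have h : Measurable fun q : Label × ℝ => φ q.1 q.2 :=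
    measurable_from_prod_countable_right fun y => (hφ y).differentiable.continuous.measurable
  have hz := (continuous_fourierFeature u).measurable
  exact h.comp (measurable_fst.snd.prodMk (measurable_snd.inner (hz.comp measurable_fst.fst)))

theorem measurable_gradient_exampleLoss (hφ : ∀ y, SmoothConvexLink L β (φ y))
    (u : Fin D → Input d) :
    Measurable fun q : Example d × Weight D => ∇ (exampleLoss φ u q.1) q.2 := by
  simp only [gradient_exampleLoss fun y => (hφ y).differentiable]
  have h : Measurable fun q : Label × ℝ => deriv (φ q.1) q.2 :=
    measurable_from_prod_countable_right fun y => (hφ y).continuous_deriv.measurable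
  have hz := (continuous_fourierFeature u).measurable
  exact (h.comp (measurable_fst.snd.prodMk
    (measurable_snd.inner (hz.comp measurable_fst.fst)))).smul (hz.comp measurable_fst.fst)

theorem empRisk_sub_le (hD : 1 ≤ D) {n : ℕ} (hn : 1 ≤ n) (hφ : ∀ y, SmoothConvexLink L β (φ y))
    (u : Fin D → Input d) (S : Fin n → Example d) (v w : Weight D) :
    |empRisk φ u S v - empRisk φ u S w| ≤ L * ‖v - w‖ := by
  have hn0 : (0 : ℝ) < n := by exact_mod_cast hn
  rw [empRisk, empRisk, ← mul_sub, ← Finset.sum_sub_distrib, abs_mul,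
    abs_of_pos (one_div_pos.2 hn0)]
  have := (Finset.abs_sum_le_sum_abs _ _).trans
    (Finset.sum_le_sum fun i (_ : i ∈ Finset.univ) => exampleLoss_sub_le hD hφ u (S i) v w)
  rw [Finset.sum_const, Finset.card_univ, Fintype.card_fin, nsmul_eq_mul] at this
  rw [one_div, inv_mul_le_iff₀ hn0]
  exact this

theorem abs_empRisk_le (hD : 1 ≤ D) {n : ℕ} (hn : 1 ≤ n) (hφ : ∀ y, SmoothConvexLink L β (φ y))
    {C : ℝ} (hC : ∀ y, |φ y 0| ≤ C) (u : Fin D → Input d) (S : Fin n → Example d) (w : Weight D) :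
    |empRisk φ u S w| ≤ C + L * ‖w‖ := by
  have hn0 : (0 : ℝ) < n := by exact_mod_cast hn
  rw [empRisk, abs_mul, abs_of_pos (one_div_pos.2 hn0)]
  have := (Finset.abs_sum_le_sum_abs _ _).trans
    (Finset.sum_le_sum fun i (_ : i ∈ Finset.univ) => abs_exampleLoss_le hD hφ hC u (S i) w)
  rw [Finset.sum_const, Finset.card_univ, Fintype.card_fin, nsmul_eq_mul] at this
  rw [one_div, inv_mul_le_iff₀ hn0]
  exact this

theorem convexOn_empRisk {n : ℕ} (hφ : ∀ y, SmoothConvexLink L β (φ y)) (u : Fin D → Input d)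
    (S : Fin n → Example d) : ConvexOn ℝ Set.univ (empRisk φ u S) := by
  have : ConvexOn ℝ Set.univ fun w => ∑ i, exampleLoss φ u (S i) w := by
    refine ⟨convex_univ, fun v _ w _ a b ha hb hab => ?_⟩
    simp only [smul_eq_mul, Finset.mul_sum, ← Finset.sum_add_distrib]
    exact Finset.sum_le_sum fun i _ =>
      (convexOn_exampleLoss hφ u (S i)).2 (Set.mem_univ v) (Set.mem_univ w) ha hb hab
  exact this.smul (by positivity : (0 : ℝ) ≤ 1 / n)

theorem measurable_empRisk {n : ℕ} (hφ : ∀ y, SmoothConvexLink L β (φ y)) (u : Fin D → Input d) :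
    Measurable fun q : (Fin n → Example d) × Weight D => empRisk φ u q.1 q.2 := by
  refine (Finset.measurable_sum _ fun i _ => ?_).const_mul _
  have hi : Measurable fun q : (Fin n → Example d) × Weight D => (q.1 i, q.2) :=
    ((measurable_pi_apply i).comp measurable_fst).prodMk measurable_snd
  exact (measurable_exampleLoss hφ u).comp hi

/-! ### Stochastic gradient steps along a fixed sequence of examples -/

variable {η : ℝ}

theorem measurable_sgmIterate (hφ : ∀ y, SmoothConvexLink L β (φ y)) (u : Fin D → Input d)
    (η : ℝ) (t : ℕ) : Measurable (sgmIterate φ u η t) := by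
  induction t with
  | zero => exact measurable_const
  | succ t ih =>
    have hinit : Measurable fun e : Fin (t + 1) → Example d => (Fin.init e : Fin t → Example d) :=
      measurable_pi_lambda _ fun s => measurable_pi_apply _
    have hw := ih.comp hinit
    exact hw.sub (((measurable_gradient_exampleLoss hφ u).comp
      ((measurable_pi_apply (Fin.last t)).prodMk hw)).const_smul η)

theorem norm_sgmIterate_le (hD : 1 ≤ D) (hφ : ∀ y, SmoothConvexLink L β (φ y)) (hη : 0 ≤ η)
    (u : Fin D → Input d) (t : ℕ) (e : Fin t → Example d) :
    ‖sgmIterate φ u η t e‖ ≤ t * (η * L) := by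
  induction t with
  | zero => simp [sgmIterate]
  | succ t ih =>
    rw [sgmIterate]
    refine (norm_sub_le _ _).trans ?_
    rw [norm_smul, Real.norm_of_nonneg hη]
    have h1 := ih (Fin.init e)
    have h2 := mul_le_mul_of_nonneg_left (norm_gradient_exampleLoss_le hD hφ u (e (Fin.last t))
      (sgmIterate φ u η t (Fin.init e))) hη
    push_cast
    linarith

/-- The regret of the stochastic gradient method against a fixed vector `v`. -/
theorem sgmIterate_regret (hD : 1 ≤ D) (hφ : ∀ y, SmoothConvexLink L β (φ y)) (hη : 0 ≤ η)
    (u : Fin D → Input d) (v : Weight D) (t : ℕ) (e : Fin t → Example d) :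
    ‖sgmIterate φ u η t e - v‖ ^ 2 + 2 * η * ∑ s : Fin t,
        (exampleLoss φ u (e s) (sgmIterate φ u η s fun r : Fin s => e (Fin.castLE s.isLt.le r))
          - exampleLoss φ u (e s) v)
      ≤ ‖v‖ ^ 2 + t * (η * L) ^ 2 := by
  induction t with
  | zero => simp [sgmIterate]
  | succ t ih =>
    rw [Fin.sum_univ_castSucc]
    have h1 := ih (Fin.init e)
    set w := sgmIterate φ u η t (Fin.init e) with hw
    set g := ∇ (exampleLoss φ u (e (Fin.last t))) w with hg
    have hstep : ‖sgmIterate φ u η (t + 1) e - v‖ ^ 2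
        = ‖w - v‖ ^ 2 - 2 * η * ⟪g, w - v⟫ + (η * ‖g‖) ^ 2 := by
      rw [sgmIterate, ← hw, ← hg, sub_right_comm, norm_sub_sq_real, inner_smul_right, norm_smul,
        Real.norm_of_nonneg hη, real_inner_comm]
      ring
    have hconv := mul_le_mul_of_nonneg_left
      (exampleLoss_sub_le_inner_gradient hφ u (e (Fin.last t)) w v) hη
    have hgL : (η * ‖g‖) ^ 2 ≤ (η * L) ^ 2 := by
      have := norm_gradient_exampleLoss_le hD hφ u (e (Fin.last t)) w
      gcongr
    have hlast : sgmIterate φ u η (Fin.last t : Fin (t + 1))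
        (fun r => e (Fin.castLE (Fin.last t).isLt.le r)) = w := rfl
    rw [hlast, hstep]
    have hsum : ∑ s : Fin t, (exampleLoss φ u (e s.castSucc)
          (sgmIterate φ u η s.castSucc fun r => e (Fin.castLE s.castSucc.isLt.le r))
          - exampleLoss φ u (e s.castSucc) v)
        = ∑ s : Fin t, (exampleLoss φ u (Fin.init e s)
          (sgmIterate φ u η s fun r : Fin s => (Fin.init e : Fin t → Example d)
            (Fin.castLE s.isLt.le r)) - exampleLoss φ u (Fin.init e s) v) := rfl
    rw [hsum]
    push_cast
    linarith

/-- Changing some of the examples moves the iterate by at most `2 η L` for each of them. -/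
theorem norm_sgmIterate_sub_le (hD : 1 ≤ D) (hφ : ∀ y, SmoothConvexLink L β (φ y)) (hη : 0 ≤ η)
    (hηβ : η * β ≤ 2) (u : Fin D → Input d) (t : ℕ) (e e' : Fin t → Example d)
    (q : Fin t → Prop) [DecidablePred q] (hq : ∀ s, ¬ q s → e s = e' s) :
    ‖sgmIterate φ u η t e - sgmIterate φ u η t e'‖
      ≤ ∑ s : Fin t, if q s then 2 * (η * L) else 0 := by
  induction t with
  | zero => simp [sgmIterate]
  | succ t ih =>
    rw [Fin.sum_univ_castSucc, sgmIterate, sgmIterate]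
    have h1 := ih (Fin.init e) (Fin.init e') (fun s => q s.castSucc) fun s hs => hq _ hs
    set w := sgmIterate φ u η t (Fin.init e)
    set w' := sgmIterate φ u η t (Fin.init e')
    by_cases hl : q (Fin.last t)
    · rw [if_pos hl]
      have hb : ∀ (a : Example d) (x : Weight D), ‖η • ∇ (exampleLoss φ u a) x‖ ≤ η * L :=
        fun a x => by
          rw [norm_smul, Real.norm_of_nonneg hη]
          exact mul_le_mul_of_nonneg_left (norm_gradient_exampleLoss_le hD hφ u a x) hη
      have h2 := hb (e (Fin.last t)) w
      have h3 := hb (e' (Fin.last t)) w'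
      rw [sub_sub_sub_comm]
      have h4 := norm_sub_le (w - w')
        (η • ∇ (exampleLoss φ u (e (Fin.last t))) w - η • ∇ (exampleLoss φ u (e' (Fin.last t))) w')
      have h5 := norm_sub_le (η • ∇ (exampleLoss φ u (e (Fin.last t))) w)
        (η • ∇ (exampleLoss φ u (e' (Fin.last t))) w')
      linarith
    · rw [if_neg hl, add_zero, hq _ hl, gradient_exampleLoss fun y => (hφ y).differentiable,
        gradient_exampleLoss fun y => (hφ y).differentiable]
      exact ((hφ _).norm_step_sub_step_le hη hηβ (norm_fourierFeature hD _ _) w w').trans h1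

end Loss

/-! ### Resampling one coordinate -/

theorem measurable_update_prod {ι α : Type*} [DecidableEq ι] [MeasurableSpace α] (j : ι) :
    Measurable fun q : (ι → α) × α => Function.update q.1 j q.2 := by
  refine measurable_pi_lambda _ fun k => ?_
  by_cases hk : k = j
  · subst hk
    simpa using measurable_snd
  · simp only [Function.update_of_ne hk]
    exact (measurable_pi_apply k).comp measurable_fst

theorem measurePreserving_update_pi {ι α : Type*} [Fintype ι] [DecidableEq ι] [MeasurableSpace α]
    (μ : Measure α) [IsProbabilityMeasure μ] (j : ι) :
    MeasurePreserving (fun q : (ι → α) × α => Function.update q.1 j q.2)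
      ((Measure.pi fun _ => μ).prod μ) (Measure.pi fun _ => μ) := by
  refine ⟨measurable_update_prod j, (Measure.pi_eq fun s hs => ?_).symm⟩
  rw [Measure.map_apply (measurable_update_prod j) (MeasurableSet.univ_pi hs)]
  have hpre : (fun q : (ι → α) × α => Function.update q.1 j q.2) ⁻¹' Set.univ.pi s
      = Set.univ.pi (Function.update s j Set.univ) ×ˢ s j := by
    ext q
    simp only [Set.mem_preimage, Set.mem_pi, Set.mem_univ, true_implies, Set.mem_prod]
    constructor
    · refine fun h => ⟨fun k => ?_, by simpa using h j⟩
      by_cases hk : k = j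
      · subst hk; simp
      · simpa [Function.update_of_ne hk] using h k
    · rintro ⟨h1, h2⟩ k
      by_cases hk : k = j
      · subst hk; simpa using h2
      · simpa [Function.update_of_ne hk] using h1 k
  rw [hpre, Measure.prod_prod, Measure.pi_pi, ← Finset.mul_prod_erase _ _ (Finset.mem_univ j),
    ← Finset.mul_prod_erase (Finset.univ : Finset ι) (fun k => μ (s k)) (Finset.mem_univ j),
    Function.update_self, measure_univ, one_mul, mul_comm]
  congr 1
  exact Finset.prod_congr rfl fun k hk => by rw [Function.update_of_ne (Finset.ne_of_mem_erase hk)]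

theorem integral_update_pi {ι α : Type*} [Fintype ι] [DecidableEq ι] [MeasurableSpace α]
    (μ : Measure α) [IsProbabilityMeasure μ] (j : ι) {H : (ι → α) → ℝ}
    (hH : Integrable H (Measure.pi fun _ => μ)) :
    Integrable (fun q : (ι → α) × α => H (Function.update q.1 j q.2))
        ((Measure.pi fun _ => μ).prod μ) ∧
      ∫ q : (ι → α) × α, H (Function.update q.1 j q.2) ∂((Measure.pi fun _ => μ).prod μ)
        = ∫ x, H x ∂(Measure.pi fun _ => μ) := by
  have hmp := measurePreserving_update_pi μ j
  refine ⟨hmp.integrable_comp_of_integrable hH, ?_⟩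
  have hH' : AEStronglyMeasurable H (Measure.map (fun q : (ι → α) × α =>
      Function.update q.1 j q.2) ((Measure.pi fun _ => μ).prod μ)) := by
    rw [hmp.map_eq]; exact hH.aestronglyMeasurable
  rw [← integral_map hmp.measurable.aemeasurable hH', hmp.map_eq]

theorem integral_uniformOn_univ {ι : Type*} [Fintype ι] [Nonempty ι] [MeasurableSpace ι]
    [MeasurableSingletonClass ι] (f : ι → ℝ) :
    ∫ i, f i ∂(uniformOn (Set.univ : Set ι)) = (1 / (Fintype.card ι : ℝ)) * ∑ i, f i := by
  rw [uniformOn, ProbabilityTheory.cond, integral_smul_measure, Measure.restrict_univ, integral_count,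
    Measure.count_univ]
  simp

instance isProbabilityMeasure_sampleLaw {d : ℕ} (n : ℕ) (P : Measure (Example d))
    [IsProbabilityMeasure P] : IsProbabilityMeasure (sampleLaw n P) := by
  unfold sampleLaw; infer_instance

theorem isProbabilityMeasure_uniformOn_univ {n : ℕ} (hn : 1 ≤ n) :
    IsProbabilityMeasure (uniformOn (Set.univ : Set (Fin n))) :=
  isProbabilityMeasure_uniformOn Set.finite_univ ⟨⟨0, hn⟩, Set.mem_univ _⟩

theorem isProbabilityMeasure_indexLaw {n : ℕ} (hn : 1 ≤ n) (T : ℕ) :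
    IsProbabilityMeasure (indexLaw n T) := by
  have := isProbabilityMeasure_uniformOn_univ hn
  unfold indexLaw; infer_instance

/-! ### The averaged iterate -/

section Average

variable {d D n T : ℕ} {φ : Label → ℝ → ℝ} {L β η : ℝ}

theorem measurable_sgmAverage (hφ : ∀ y, SmoothConvexLink L β (φ y)) (u : Fin D → Input d)
    (η : ℝ) (i : Fin T → Fin n) : Measurable fun S => sgmAverage φ u η S i := by
  have h : ∀ t : Fin T, Measurable fun S : Fin n → Example d =>
      sgmIterate φ u η t fun s : Fin t => S (i (Fin.castLE t.isLt.le s)) := fun t =>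
    (measurable_sgmIterate hφ u η t).comp
      (measurable_pi_lambda _ fun s => measurable_pi_apply _)
  exact (Finset.measurable_sum Finset.univ fun t _ => h t).const_smul (1 / (T : ℝ))

theorem measurable_sgmAverage_prod (hφ : ∀ y, SmoothConvexLink L β (φ y)) (u : Fin D → Input d)
    (η : ℝ) : Measurable fun ω : (Fin n → Example d) × (Fin T → Fin n) =>
      sgmAverage φ u η ω.1 ω.2 :=
  measurable_from_prod_countable_left fun i => measurable_sgmAverage hφ u η i

theorem norm_sgmAverage_le (hD : 1 ≤ D) (hT : 1 ≤ T) (hφ : ∀ y, SmoothConvexLink L β (φ y))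
    (hη : 0 ≤ η) (hL : 0 ≤ L) (u : Fin D → Input d) (S : Fin n → Example d) (i : Fin T → Fin n) :
    ‖sgmAverage φ u η S i‖ ≤ T * (η * L) := by
  have hT0 : (0 : ℝ) < T := by exact_mod_cast hT
  rw [sgmAverage, norm_smul, Real.norm_of_nonneg (by positivity), one_div, inv_mul_le_iff₀ hT0]
  have h : ∀ t : Fin T, ‖sgmIterate φ u η t fun s : Fin t => S (i (Fin.castLE t.isLt.le s))‖
      ≤ T * (η * L) := fun t => by
    have ht : ((t : ℕ) : ℝ) ≤ T := by exact_mod_cast t.isLt.le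
    exact (norm_sgmIterate_le hD hφ hη u t _).trans
      (mul_le_mul_of_nonneg_right ht (mul_nonneg hη hL))
  exact (norm_sum_le _ _).trans ((Finset.sum_le_sum fun t _ => h t).trans_eq (by simp))

/-- Expected optimization error of the averaged iterate on a fixed training set. -/
theorem integral_empRisk_sgmAverage_le (hD : 1 ≤ D) (hn : 1 ≤ n) (hT : 1 ≤ T)
    (hφ : ∀ y, SmoothConvexLink L β (φ y)) (hη : 0 ≤ η) (u : Fin D → Input d)
    (S : Fin n → Example d) (v : Weight D) :
    2 * η * T * (∫ i, empRisk φ u S (sgmAverage φ u η S i) ∂(indexLaw n T) - empRisk φ u S v)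
      ≤ ‖v‖ ^ 2 + T * (η * L) ^ 2 := by
  have := isProbabilityMeasure_indexLaw hn T
  have := isProbabilityMeasure_uniformOn_univ hn
  have : Nonempty (Fin n) := ⟨⟨0, hn⟩⟩
  have hT0 : (0 : ℝ) < T := by exact_mod_cast hT
  let w : Fin T → (Fin T → Fin n) → Weight D := fun t i =>
    sgmIterate φ u η t fun s : Fin t => S (i (Fin.castLE t.isLt.le s))
  have hint : ∀ F : (Fin T → Fin n) → ℝ, Integrable F (indexLaw n T) := fun F => .of_finite
  have hresample : ∀ t, ∫ i, exampleLoss φ u (S (i t)) (w t i) ∂(indexLaw n T)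
      = ∫ i, empRisk φ u S (w t i) ∂(indexLaw n T) := by
    intro t
    obtain ⟨h1, h2⟩ := integral_update_pi (uniformOn (Set.univ : Set (Fin n))) t
      (hint fun i => exampleLoss φ u (S (i t)) (w t i))
    rw [integral_prod _ h1] at h2
    refine h2.symm.trans (integral_congr_ae (.of_forall fun i => ?_))
    dsimp only
    rw [integral_uniformOn_univ, Fintype.card_fin]
    have hw : ∀ j, w t (Function.update i t j) = w t i := fun j => by
      simp only [w]
      congr 1
      funext s
      rw [Function.update_of_ne]
      exact fun h => absurd (congrArg Fin.val h) (by simpa using s.isLt.ne)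
    simp only [Function.update_self, hw, empRisk]
  have hjensen : ∀ i, T * empRisk φ u S (sgmAverage φ u η S i) ≤ ∑ t, empRisk φ u S (w t i) := by
    intro i
    have := (convexOn_empRisk hφ u S).map_sum_le (t := Finset.univ) (w := fun _ : Fin T => 1 / (T : ℝ))
      (p := fun t => w t i) (fun _ _ => by positivity) (by simp [hT0.ne'])
      (fun _ _ => Set.mem_univ _)
    rw [← Finset.smul_sum, ← Finset.smul_sum, smul_eq_mul, one_div, le_inv_mul_iff₀ hT0,
      ← one_div] at this
    exact this
  have hregret : ∀ i, 2 * η * ((∑ t, exampleLoss φ u (S (i t)) (w t i))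
      - ∑ t, exampleLoss φ u (S (i t)) v) ≤ ‖v‖ ^ 2 + T * (η * L) ^ 2 := by
    intro i
    have := sgmIterate_regret hD hφ hη u v T fun t => S (i t)
    rw [Finset.sum_sub_distrib] at this
    exact (le_add_of_nonneg_left (sq_nonneg _)).trans this
  have hv : ∀ t : Fin T, ∫ i, exampleLoss φ u (S (i t)) v ∂(indexLaw n T) = empRisk φ u S v := by
    intro t
    obtain ⟨h1, h2⟩ := integral_update_pi (uniformOn (Set.univ : Set (Fin n))) t
      (hint fun i => exampleLoss φ u (S (i t)) v)
    rw [integral_prod _ h1] at h2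
    refine h2.symm.trans ?_
    simp only [Function.update_self, integral_uniformOn_univ, Fintype.card_fin]
    rw [integral_const, probReal_univ, one_smul, empRisk]
  have h3 := integral_mono (hint _) (hint _) hregret
  rw [integral_const_mul, integral_sub (hint _) (hint _), integral_finsetSum _ fun _ _ => hint _,
    integral_finsetSum _ fun _ _ => hint _] at h3
  simp only [hresample, hv, integral_const, probReal_univ, one_smul, Finset.sum_const,
    Finset.card_univ, Fintype.card_fin, nsmul_eq_mul] at h3
  have h4 := integral_mono (hint _) (hint _) hjensen
  rw [integral_const_mul, integral_finsetSum _ fun _ _ => hint _] at h4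
  refine le_trans ?_ h3
  rw [mul_assoc]
  exact mul_le_mul_of_nonneg_left (by linarith) (by positivity)

/-- Stability of the averaged iterate, summed over the training example that is replaced. -/
theorem sum_norm_sgmAverage_sub_update_le (hD : 1 ≤ D) (hT : 1 ≤ T)
    (hφ : ∀ y, SmoothConvexLink L β (φ y)) (hη : 0 ≤ η) (hL : 0 ≤ L) (hηβ : η * β ≤ 2)
    (u : Fin D → Input d) (S : Fin n → Example d) (i : Fin T → Fin n) (e : Example d) :
    ∑ j, ‖sgmAverage φ u η S i - sgmAverage φ u η (Function.update S j e) i‖ ≤ T * (η * L) := by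
  have hT0 : (0 : ℝ) < T := by exact_mod_cast hT
  have hj : ∀ j, ‖sgmAverage φ u η S i - sgmAverage φ u η (Function.update S j e) i‖
      ≤ (1 / (T : ℝ)) * ∑ t : Fin T, ∑ s : Fin t,
        if i (Fin.castLE t.isLt.le s) = j then 2 * (η * L) else 0 := by
    intro j
    rw [sgmAverage, sgmAverage, ← smul_sub, norm_smul, Real.norm_of_nonneg (by positivity),
      ← Finset.sum_sub_distrib]
    refine mul_le_mul_of_nonneg_left ((norm_sum_le _ _).trans (Finset.sum_le_sum fun t _ => ?_))
      (by positivity)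
    exact norm_sgmIterate_sub_le hD hφ hη hηβ u t _ _
      (fun s => i (Fin.castLE t.isLt.le s) = j)
      fun s hs => by rw [Function.update_of_ne hs]
  refine (Finset.sum_le_sum fun j _ => hj j).trans ?_
  rw [← Finset.mul_sum, Finset.sum_comm, one_div, inv_mul_le_iff₀ hT0]
  have ht : ∀ t : Fin T, ∑ j : Fin n, ∑ s : Fin t,
      (if i (Fin.castLE t.isLt.le s) = j then 2 * (η * L) else 0) = (t : ℕ) * (2 * (η * L)) := by
    intro t
    rw [Finset.sum_comm]
    simp
  rw [Finset.sum_congr rfl fun t _ => ht t, ← Finset.sum_mul]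
  have hgauss : (∑ t : Fin T, ((t : ℕ) : ℝ)) * 2 ≤ T * T := by
    rw [Fin.sum_univ_eq_sum_range (fun t => (t : ℝ)) T]
    have h : (∑ t ∈ Finset.range T, t) * 2 ≤ T * T := by
      rw [Finset.sum_range_id_mul_two]; exact Nat.mul_le_mul_left _ (Nat.sub_le _ _)
    have h' : (((∑ t ∈ Finset.range T, t) * 2 : ℕ) : ℝ) ≤ ((T * T : ℕ) : ℝ) := Nat.cast_le.2 h
    push_cast at h'
    exact h'
  have := mul_le_mul_of_nonneg_right hgauss (mul_nonneg hη hL)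
  linarith

variable {P : Measure (Example d)} [IsProbabilityMeasure P]

theorem integrable_exampleLoss (hD : 1 ≤ D) (hφ : ∀ y, SmoothConvexLink L β (φ y)) {C : ℝ}
    (hC : ∀ y, |φ y 0| ≤ C) (u : Fin D → Input d) (w : Weight D) :
    Integrable (fun e => exampleLoss φ u e w) P :=
  .of_bound ((measurable_exampleLoss hφ u).comp
    (measurable_id.prodMk measurable_const)).aestronglyMeasurable _
    (.of_forall fun e => abs_exampleLoss_le hD hφ hC u e w)

theorem abs_risk_le (hD : 1 ≤ D) (hφ : ∀ y, SmoothConvexLink L β (φ y)) {C : ℝ}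
    (hC : ∀ y, |φ y 0| ≤ C) (u : Fin D → Input d) (w : Weight D) :
    |risk φ u P w| ≤ C + L * ‖w‖ := by
  have := norm_integral_le_of_norm_le_const (μ := P) (f := fun e => exampleLoss φ u e w)
    (.of_forall fun e => abs_exampleLoss_le hD hφ hC u e w)
  rwa [probReal_univ, mul_one] at this

theorem measurable_risk (hφ : ∀ y, SmoothConvexLink L β (φ y)) (u : Fin D → Input d) :
    Measurable (risk φ u P) := by
  have h : StronglyMeasurable (Function.uncurry fun (w : Weight D) (e : Example d) =>
      exampleLoss φ u e w) :=
    ((measurable_exampleLoss hφ u).comp measurable_swap).stronglyMeasurable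
  exact (h.integral_prod_right (ν := P)).measurable

/-- The expected generalization gap of the averaged iterate, for fixed indices. -/
theorem integral_risk_sgmAverage_le (hD : 1 ≤ D) (hn : 1 ≤ n) (hT : 1 ≤ T)
    (hφ : ∀ y, SmoothConvexLink L β (φ y)) (hη : 0 ≤ η) (hL : 0 ≤ L) (hηβ : η * β ≤ 2) {C : ℝ}
    (hC : ∀ y, |φ y 0| ≤ C) (u : Fin D → Input d) (i : Fin T → Fin n) :
    ∫ S, risk φ u P (sgmAverage φ u η S i) ∂(sampleLaw n P)
      ≤ ∫ S, empRisk φ u S (sgmAverage φ u η S i) ∂(sampleLaw n P) + L * (T * (η * L)) / n := by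
  have hn0 : (0 : ℝ) < n := by exact_mod_cast hn
  let w : (Fin n → Example d) → Weight D := fun S => sgmAverage φ u η S i
  have hw : Measurable w := measurable_sgmAverage hφ u η i
  have hb : ∀ e S, |exampleLoss φ u e (w S)| ≤ C + L * (T * (η * L)) := fun e S =>
    (abs_exampleLoss_le hD hφ hC u e _).trans (add_le_add_right
      (mul_le_mul_of_nonneg_left (norm_sgmAverage_le hD hT hφ hη hL u S i) hL) C)
  have hfresh : Integrable (fun q : (Fin n → Example d) × Example d => exampleLoss φ u q.2 (w q.1))
      ((sampleLaw n P).prod P) :=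
    .of_bound ((measurable_exampleLoss hφ u).comp
      (measurable_snd.prodMk (hw.comp measurable_fst))).aestronglyMeasurable _
      (.of_forall fun q => hb q.2 q.1)
  have hmem : ∀ j, Integrable (fun S => exampleLoss φ u (S j) (w S)) (sampleLaw n P) := fun j =>
    .of_bound ((measurable_exampleLoss hφ u).comp
      ((measurable_pi_apply j).prodMk hw)).aestronglyMeasurable _ (.of_forall fun S => hb _ S)
  have hup : ∀ j, Integrable (fun q : (Fin n → Example d) × Example d =>
        exampleLoss φ u q.2 (w (Function.update q.1 j q.2))) ((sampleLaw n P).prod P) ∧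
      ∫ q : (Fin n → Example d) × Example d, exampleLoss φ u q.2 (w (Function.update q.1 j q.2))
          ∂((sampleLaw n P).prod P)
        = ∫ S, exampleLoss φ u (S j) (w S) ∂(sampleLaw n P) := fun j => by
    have h := integral_update_pi P j (hmem j)
    simp only [Function.update_self] at h
    exact h
  have hpt : ∀ q : (Fin n → Example d) × Example d, exampleLoss φ u q.2 (w q.1)
      ≤ (1 / (n : ℝ)) * ∑ j, exampleLoss φ u q.2 (w (Function.update q.1 j q.2))
        + L * (T * (η * L)) / n := by
    rintro ⟨S, e⟩
    have h1 : ∑ j, (exampleLoss φ u e (w S) - exampleLoss φ u e (w (Function.update S j e)))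
        ≤ L * (T * (η * L)) := by
      refine (Finset.sum_le_sum fun j _ => (le_abs_self _).trans
        (exampleLoss_sub_le hD hφ u e _ _)).trans ?_
      rw [← Finset.mul_sum]
      exact mul_le_mul_of_nonneg_left
        (sum_norm_sgmAverage_sub_update_le hD hT hφ hη hL hηβ u S i e) hL
    rw [Finset.sum_sub_distrib, Finset.sum_const, Finset.card_univ, Fintype.card_fin,
      nsmul_eq_mul] at h1
    rw [one_div, inv_mul_eq_div, ← add_div, le_div_iff₀ hn0]
    linarith
  have hsum : Integrable (fun q : (Fin n → Example d) × Example d =>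
      ∑ j, exampleLoss φ u q.2 (w (Function.update q.1 j q.2))) ((sampleLaw n P).prod P) :=
    integrable_finsetSum _ fun j _ => (hup j).1
  have h2 := integral_mono hfresh ((hsum.const_mul _).add (integrable_const _)) hpt
  rw [integral_prod _ hfresh] at h2
  refine h2.trans_eq ?_
  simp only [Pi.add_apply]
  rw [integral_add (hsum.const_mul _) (integrable_const _), integral_const, probReal_univ,
    one_smul, integral_const_mul, integral_finsetSum _ fun j _ => (hup j).1]
  simp only [empRisk]
  rw [integral_const_mul, integral_finsetSum _ fun j _ => hmem j]
  congr 2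
  exact Finset.sum_congr rfl fun j _ => (hup j).2

end Average

/-! ### Empirical minimizers -/

theorem ciInf_denseSeq_eq {E : Type*} [TopologicalSpace E] [TopologicalSpace.SeparableSpace E]
    [Nonempty E] {F : E → ℝ} (hF : Continuous F) {v : E} (hv : ∀ w, F v ≤ F w) :
    ⨅ k, F (TopologicalSpace.denseSeq E k) = F v := by
  refine le_antisymm ?_ (le_ciInf fun k => hv _)
  have hbdd : BddBelow (Set.range fun k => F (TopologicalSpace.denseSeq E k)) :=
    ⟨F v, by rintro _ ⟨k, rfl⟩; exact hv _⟩
  have hcl : IsClosed {w | ⨅ k, F (TopologicalSpace.denseSeq E k) ≤ F w} :=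
    isClosed_le continuous_const hF
  have hsub : Set.range (TopologicalSpace.denseSeq E) ⊆
      {w | ⨅ k, F (TopologicalSpace.denseSeq E k) ≤ F w} :=
    Set.range_subset_iff.2 fun k => ciInf_le hbdd k
  have := closure_minimal hsub hcl
  rw [(TopologicalSpace.denseRange_denseSeq E).closure_range] at this
  exact this (Set.mem_univ v)

/-- A bound on the second moment of `a`, which need not be measurable, bounds the integral of
measurable functions dominated by `a ^ 2`. -/
theorem integral_le_of_le_mul_sq {Ω : Type*} [MeasurableSpace Ω] {μ : Measure Ω}
    [IsProbabilityMeasure μ] {a h : Ω → ℝ} {B κ c : ℝ} (hκ : 0 ≤ κ) (hh : Integrable h μ)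
    (ha : ∫⁻ x, ENNReal.ofReal (a x ^ 2) ∂μ ≤ ENNReal.ofReal (B ^ 2))
    (hle : ∀ᵐ x ∂μ, h x ≤ κ * a x ^ 2 + c) : ∫ x, h x ∂μ ≤ κ * B ^ 2 + c := by
  have hint : ∫ x, (h x - c) ∂μ = ∫ x, h x ∂μ - c := by
    rw [integral_sub hh (integrable_const c), integral_const, probReal_univ, one_smul]
  have hup : ∫⁻ x, ENNReal.ofReal (h x - c) ∂μ ≤ ENNReal.ofReal (κ * B ^ 2) := calc
    _ ≤ ∫⁻ x, ENNReal.ofReal κ * ENNReal.ofReal (a x ^ 2) ∂μ := by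
      refine lintegral_mono_ae (hle.mono fun x hx => ?_)
      rw [← ENNReal.ofReal_mul hκ]
      exact ENNReal.ofReal_le_ofReal (by linarith)
    _ = ENNReal.ofReal κ * ∫⁻ x, ENNReal.ofReal (a x ^ 2) ∂μ :=
      lintegral_const_mul' _ _ ENNReal.ofReal_ne_top
    _ ≤ ENNReal.ofReal κ * ENNReal.ofReal (B ^ 2) := mul_le_mul_right ha _
    _ = _ := (ENNReal.ofReal_mul hκ).symm
  have h1 := integral_eq_lintegral_pos_part_sub_lintegral_neg_part (hh.sub (integrable_const c))
  simp only [Pi.sub_apply] at h1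
  have h2 := ENNReal.toReal_mono ENNReal.ofReal_ne_top hup
  rw [ENNReal.toReal_ofReal (by positivity)] at h2
  have h3 : 0 ≤ (∫⁻ x, ENNReal.ofReal (-(h x - c)) ∂μ).toReal := ENNReal.toReal_nonneg
  linarith

theorem integrable_empRisk_minimizer {d D n : ℕ} (hD : 1 ≤ D) (hn : 1 ≤ n) {φ : Label → ℝ → ℝ}
    {L β : ℝ} (hL : 0 ≤ L) (hφ : ∀ y, SmoothConvexLink L β (φ y)) {C : ℝ}
    (hC : ∀ y, |φ y 0| ≤ C) (u : Fin D → Input d) {P : Measure (Example d)}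
    [IsProbabilityMeasure P] {w : (Fin n → Example d) → Weight D} {a : (Fin n → Example d) → ℝ}
    (hw : ∀ S, ‖w S‖ ≤ a S) (ha : ∫⁻ S, ENNReal.ofReal (a S ^ 2) ∂(sampleLaw n P) ≠ ⊤)
    (hmin : ∀ᵐ S ∂(sampleLaw n P), ∀ v, empRisk φ u S (w S) ≤ empRisk φ u S v) :
    Integrable (fun S => empRisk φ u S (w S)) (sampleLaw n P) := by
  have hC0 : 0 ≤ C := (abs_nonneg _).trans (hC ⟨1, by simp⟩)
  constructor
  · have hinf : Measurable fun S : Fin n → Example d =>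
        ⨅ k, empRisk φ u S (TopologicalSpace.denseSeq (Weight D) k) :=
      .iInf fun k => (measurable_empRisk hφ u).comp (measurable_id.prodMk measurable_const)
    refine ⟨_, hinf.stronglyMeasurable, hmin.mono fun S hS => (ciInf_denseSeq_eq ?_ hS).symm⟩
    refine (LipschitzWith.of_dist_le_mul (K := L.toNNReal) fun v w => ?_).continuous
    rw [Real.dist_eq, dist_eq_norm, Real.coe_toNNReal _ hL]
    exact empRisk_sub_le hD hn hφ u S v w
  · rw [hasFiniteIntegral_iff_norm]
    calc ∫⁻ S, ENNReal.ofReal ‖empRisk φ u S (w S)‖ ∂(sampleLaw n P)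
        ≤ ∫⁻ S, (ENNReal.ofReal (C + L) + ENNReal.ofReal L * ENNReal.ofReal (a S ^ 2))
            ∂(sampleLaw n P) := by
          refine lintegral_mono fun S => ?_
          dsimp only
          rw [← ENNReal.ofReal_mul hL, ← ENNReal.ofReal_add (by positivity) (by positivity)]
          refine ENNReal.ofReal_le_ofReal ((abs_empRisk_le hD hn hφ hC u S _).trans ?_)
          have h1 : ‖w S‖ ≤ 1 + a S ^ 2 := by nlinarith [hw S, sq_nonneg (a S - 1)]
          nlinarith [mul_le_mul_of_nonneg_left h1 hL]
      _ = ENNReal.ofReal (C + L)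
          + ENNReal.ofReal L * ∫⁻ S, ENNReal.ofReal (a S ^ 2) ∂(sampleLaw n P) := by
          rw [lintegral_add_left measurable_const, lintegral_const, measure_univ, mul_one,
            lintegral_const_mul' _ _ ENNReal.ofReal_ne_top]
      _ < ⊤ := ENNReal.add_lt_top.2 ⟨ENNReal.ofReal_lt_top,
          ENNReal.mul_lt_top ENNReal.ofReal_lt_top ha.lt_top⟩

theorem optimalStep_nonneg {B L ε : ℝ} (hB : 0 ≤ B) (hL : 0 ≤ L) (n T : ℕ) :
    0 ≤ optimalStep B L ε n T := by
  unfold optimalStep; positivity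

theorem optimalStep_bound {B L ε : ℝ} (hB : 0 < B) (hL : 0 < L) (hε : 0 ≤ ε) {n T : ℕ}
    (hn : 1 ≤ n) (hT : 1 ≤ T) :
    0 < optimalStep B L ε n T ∧
    L * (T * (optimalStep B L ε n T * L)) / n
        + (1 / (2 * optimalStep B L ε n T * T) * B ^ 2 + optimalStep B L ε n T * L ^ 2 / 2)
      ≤ B * L * Real.sqrt (1 + ε) / Real.sqrt n * Real.sqrt (((n : ℝ) + 2 * T) / T) := by
  have hn0 : (0 : ℝ) < n := by exact_mod_cast hn
  have hT0 : (0 : ℝ) < T := by exact_mod_cast hT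
  have hq0 : (0 : ℝ) < n + 2 * T := by positivity
  have hr1 : 1 ≤ Real.sqrt (1 + ε) := Real.one_le_sqrt.2 (by linarith)
  unfold optimalStep
  rw [Real.sqrt_mul (by linarith), Real.sqrt_mul hT0.le, Real.sqrt_div hq0.le]
  set r := Real.sqrt (1 + ε)
  obtain ⟨N, hN, hN2⟩ : ∃ N, 0 < N ∧ (n : ℝ) = N ^ 2 :=
    ⟨_, Real.sqrt_pos.2 hn0, (Real.sq_sqrt hn0.le).symm⟩
  obtain ⟨τ, hτ, hτ2⟩ : ∃ τ, 0 < τ ∧ (T : ℝ) = τ ^ 2 :=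
    ⟨_, Real.sqrt_pos.2 hT0, (Real.sq_sqrt hT0.le).symm⟩
  have hQ := Real.sq_sqrt hq0.le
  have hQ0 := Real.sqrt_pos.2 hq0
  set Q := Real.sqrt ((n : ℝ) + 2 * T)
  rw [hN2, hτ2, Real.sqrt_sq hN.le, Real.sqrt_sq hτ.le]
  rw [hN2, hτ2] at hQ
  have hr0 : 0 < r := by linarith
  refine ⟨by positivity, ?_⟩
  have e1 : L * (τ ^ 2 * (B * (r * N) / (L * (τ * Q)) * L)) / N ^ 2
      + B * (r * N) / (L * (τ * Q)) * L ^ 2 / 2 = B * L * r * Q / (2 * N * τ) := by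
    have : L * (τ ^ 2 * (B * (r * N) / (L * (τ * Q)) * L)) / N ^ 2
      + B * (r * N) / (L * (τ * Q)) * L ^ 2 / 2
      = B * L * r * (N ^ 2 + 2 * τ ^ 2) / (2 * N * τ * Q) := by field_simp; ring
    rw [this, ← hQ]
    field_simp
  have e2 : 1 / (2 * (B * (r * N) / (L * (τ * Q))) * τ ^ 2) * B ^ 2
      = B * L * (1 / r) * Q / (2 * N * τ) := by field_simp
  have e3 : B * L * (1 / r) * Q / (2 * N * τ) ≤ B * L * r * Q / (2 * N * τ) := by
    have : 1 / r ≤ r := (div_le_one hr0).2 hr1 |>.trans hr1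
    gcongr
  have e4 : B * L * r / N * (Q / τ) = B * L * r * Q / (2 * N * τ) + B * L * r * Q / (2 * N * τ) := by
    field_simp; ring
  rw [e4]
  linarith

/-- The event for the frequencies can be taken to be everything: by the Cauchy–Schwarz inequality
the features satisfy `⟪z(c), z(c')⟫ ≤ 1` surely, so that `‖w_*‖ ≤ ‖f‖₁` for all frequencies
(`norm_expansionWeight_le`). -/
theorem theorem1
    {d D n T : ℕ} (hD : 1 ≤ D) (hn : 1 ≤ n) (hT : 1 ≤ T)
    -- a shift-invariant kernel `k` whose Fourier transform is the probability law `p`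
    (k : Input d → ℝ) (p : Measure (Input d)) [IsProbabilityMeasure p]
    (hkp : ∀ δ, charFun p δ = (k δ : ℂ))
    (hp : MemLp (fun v : Input d => v) 2 p)
    -- the law of the data, carried by a bounded set of inputs
    (M : Set (Input d)) (hM : Bornology.IsBounded M)
    (P : Measure (Example d)) [IsProbabilityMeasure P] (hPM : ∀ᵐ e ∂P, e.1 ∈ M)
    -- the loss
    (φ : Label → ℝ → ℝ) (L β : ℝ) (hL : 0 < L)
    (hφ : ∀ (u : Fin D → Input d), ∀ x ∈ M, ∀ y : Label,
      ConvexLipschitzSmooth L β (exampleLoss φ u (x, y)))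
    (ε : ℝ) (hε : 0 < ε) :
    -- an event for the random frequencies
    ∃ A : Set (Fin D → Input d), MeasurableSet A ∧
      1 - 2 ^ 8 * (sigmaP p * Metric.diam M / ε) ^ 2
          * Real.exp (-((D : ℝ) * ε ^ 2) / (4 * ((d : ℝ) + 2)))
        ≤ (Measure.pi fun _ : Fin D => p).real A ∧
      ∀ u ∈ A,
        -- kernel expansions `f S` of empirical risk minimizers, with `‖f‖₁` of size at most `B`
        ∀ (m : ℕ) (f : (Fin n → Example d) → Input d → ℝ)
          (α : (Fin n → Example d) → Fin m → ℝ)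
          (c : (Fin n → Example d) → Fin m → Input d) (B : ℝ),
          0 ≤ B →
          (∀ᵐ S ∂(sampleLaw n P), IsERMExpansion k φ u S (f S) (α S) (c S)) →
          (∫⁻ S, ENNReal.ofReal ((∑ t, |α S t|) ^ 2) ∂(sampleLaw n P)
            ≤ ENNReal.ofReal (B ^ 2)) →
          optimalStep B L ε n T * β ≤ 2 →
          (∀ w : Weight D, Integrable (fun e => exampleLoss φ u e w) P) ∧
          Integrable (fun ω : (Fin n → Example d) × (Fin T → Fin n) =>
              risk φ u P (sgmAverage φ u (optimalStep B L ε n T) ω.1 ω.2))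
            ((sampleLaw n P).prod (indexLaw n T)) ∧
          Integrable (fun S => empRisk φ u S (expansionWeight u (α S) (c S))) (sampleLaw n P) ∧
          ∫ ω : (Fin n → Example d) × (Fin T → Fin n),
              risk φ u P (sgmAverage φ u (optimalStep B L ε n T) ω.1 ω.2)
              ∂((sampleLaw n P).prod (indexLaw n T))
            ≤ ∫ S, empRisk φ u S (expansionWeight u (α S) (c S)) ∂(sampleLaw n P)
              + B * L * Real.sqrt (1 + ε) / Real.sqrt n
                * Real.sqrt (((n : ℝ) + 2 * T) / T) := by
  refine ⟨Set.univ, MeasurableSet.univ, ?_, ?_⟩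
  · rw [probReal_univ]
    exact sub_le_self _ (by positivity)
  intro u _ m f α c B hB herm hαB hηβ
  have := isProbabilityMeasure_indexLaw hn T
  obtain ⟨e₀, he₀⟩ := hPM.exists
  have hlink := ConvexLipschitzSmooth.smoothConvexLink hD (hφ u e₀.1 he₀)
  obtain ⟨C, hC⟩ : ∃ C, ∀ y, |φ y 0| ≤ C := by
    obtain ⟨C, hC⟩ := (Set.finite_range fun y : Label => |φ y 0|).bddAbove
    exact ⟨C, fun y => hC ⟨y, rfl⟩⟩
  have hη := optimalStep_nonneg (ε := ε) hB hL.le n T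
  set η := optimalStep B L ε n T with hη_def
  have hnorm := fun S => norm_expansionWeight_le hD u (α S) (c S)
  have havg : ∀ (S : Fin n → Example d) (i : Fin T → Fin n),
      C + L * ‖sgmAverage φ u η S i‖ ≤ C + L * (T * (η * L)) := fun S i => add_le_add_right
    (mul_le_mul_of_nonneg_left (norm_sgmAverage_le hD hT hlink hη hL.le u S i) hL.le) C
  have hrisk : Integrable (fun ω : (Fin n → Example d) × (Fin T → Fin n) =>
      risk φ u P (sgmAverage φ u η ω.1 ω.2)) ((sampleLaw n P).prod (indexLaw n T)) :=
    .of_bound ((measurable_risk hlink u).comp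
      (measurable_sgmAverage_prod hlink u η)).aestronglyMeasurable _
      (.of_forall fun ω => (abs_risk_le hD hlink hC u _).trans (havg ω.1 ω.2))
  have hemp : Integrable (fun ω : (Fin n → Example d) × (Fin T → Fin n) =>
      empRisk φ u ω.1 (sgmAverage φ u η ω.1 ω.2)) ((sampleLaw n P).prod (indexLaw n T)) :=
    .of_bound ((measurable_empRisk hlink u).comp (measurable_fst.prodMk
      (measurable_sgmAverage_prod hlink u η))).aestronglyMeasurable _
      (.of_forall fun ω => (abs_empRisk_le hD hn hlink hC u _ _).trans (havg ω.1 ω.2))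
  have hmin : Integrable (fun S => empRisk φ u S (expansionWeight u (α S) (c S)))
      (sampleLaw n P) :=
    integrable_empRisk_minimizer hD hn hL.le hlink hC u hnorm
      (hαB.trans_lt ENNReal.ofReal_lt_top).ne (herm.mono fun S hS => hS.minimizes)
  refine ⟨integrable_exampleLoss hD hlink hC u, hrisk, hmin, ?_⟩
  have hgen : ∫ ω : (Fin n → Example d) × (Fin T → Fin n),
      risk φ u P (sgmAverage φ u η ω.1 ω.2) ∂((sampleLaw n P).prod (indexLaw n T))
      ≤ ∫ S, ∫ i, empRisk φ u S (sgmAverage φ u η S i) ∂(indexLaw n T) ∂(sampleLaw n P)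
        + L * (T * (η * L)) / n := by
    rw [integral_prod_symm _ hrisk, integral_integral_swap
      (f := fun S i => empRisk φ u S (sgmAverage φ u η S i)) hemp]
    have h := integral_mono (μ := indexLaw n T) .of_finite .of_finite
      fun i => integral_risk_sgmAverage_le (P := P) hD hn hT hlink hη hL.le hηβ hC u i
    rwa [integral_add .of_finite .of_finite, integral_const (L * (T * (η * L)) / n),
      probReal_univ, one_smul] at h
  have hgap := hemp.integral_prod_left.sub hmin
  have hsplit := integral_sub hemp.integral_prod_left hmin
  rcases hB.eq_or_lt with rfl | hB
  · have hη0 : η = 0 := by simp [hη_def, optimalStep]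
    have hzero : ∀ (S : Fin n → Example d) (i : Fin T → Fin n), sgmAverage φ u η S i = 0 := by
      intro S i
      have := norm_sgmAverage_le hD hT hlink hη hL.le u S i
      rw [hη0] at this ⊢
      simpa using this
    have hle : ∀ δ > 0, ∫ S, ((∫ i, empRisk φ u S (sgmAverage φ u η S i) ∂(indexLaw n T))
        - empRisk φ u S (expansionWeight u (α S) (c S))) ∂(sampleLaw n P) ≤ L * δ := by
      intro δ hδ
      have := integral_le_of_le_mul_sq (κ := L / δ) (c := L * δ) (by positivity) hgap hαB
        (.of_forall fun S => ?_)
      · simpa using this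
      · simp only [hzero, Pi.sub_apply, integral_const, probReal_univ, one_smul]
        have h1 := (le_abs_self _).trans
          (empRisk_sub_le hD hn hlink u S 0 (expansionWeight u (α S) (c S)))
        rw [zero_sub, norm_neg] at h1
        refine h1.trans ?_
        have h2 := hnorm S
        set a := ∑ t, |α S t|
        have h3 : a ≤ a ^ 2 / δ + δ := by
          rw [div_add' _ _ _ hδ.ne', le_div_iff₀ hδ]
          nlinarith [sq_nonneg (a - δ), sq_nonneg a, sq_nonneg δ]
        calc L * ‖expansionWeight u (α S) (c S)‖ ≤ L * (a ^ 2 / δ + δ) :=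
              mul_le_mul_of_nonneg_left (h2.trans h3) hL.le
          _ = L / δ * a ^ 2 + L * δ := by ring
    have hle0 : ∫ S, ((∫ i, empRisk φ u S (sgmAverage φ u η S i) ∂(indexLaw n T))
        - empRisk φ u S (expansionWeight u (α S) (c S))) ∂(sampleLaw n P) ≤ 0 :=
      le_of_forall_pos_le_add fun δ hδ => by
        have := hle (δ / L) (by positivity)
        rwa [mul_div_cancel₀ _ hL.ne', ← zero_add δ] at this
    rw [hη0] at hgen hsplit hle0 ⊢
    simp only [zero_mul, mul_zero, zero_div, add_zero] at hgen ⊢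
    linarith
  · obtain ⟨hη0, hbound⟩ := optimalStep_bound hB hL hε.le hn hT
    rw [← hη_def] at hη0 hbound
    have hT0 : (0 : ℝ) < T := by exact_mod_cast hT
    have := integral_le_of_le_mul_sq (κ := 1 / (2 * η * T)) (c := η * L ^ 2 / 2) (by positivity)
      hgap hαB (.of_forall fun S => ?_)
    · simp only [Pi.sub_apply] at this
      linarith
    · have h1 := integral_empRisk_sgmAverage_le hD hn hT hlink hη u S
        (expansionWeight u (α S) (c S))
      have h2 : ‖expansionWeight u (α S) (c S)‖ ^ 2 ≤ (∑ t, |α S t|) ^ 2 :=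
        pow_le_pow_left₀ (norm_nonneg _) (hnorm S) 2
      have h3 : 1 / (2 * η * T) * (∑ t, |α S t|) ^ 2 + η * L ^ 2 / 2
          = ((∑ t, |α S t|) ^ 2 + T * (η * L) ^ 2) / (2 * η * T) := by
        field_simp
      rw [h3, le_div_iff₀ (by positivity), mul_comm]
      exact h1.trans (by linarith)
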